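/- Conventions. Manifolds with corners are smooth, Hausdorff and second countable, of dimension $2n$, modelled on $[0,\infty)^{2n}$; "near infinity" means outside a compact set. For a one-form $\lambda$ with $d\lambda$ symplectic, the Liouville vector field $Z$ is defined by $\iota_Z d\lambda=\lambda$. $(M,\lambda)$ is a *Liouville manifold with corners* if $d\lambda$ is symplectic, there is a smooth exhaustion function $s$ with $Z[s]=1$ near infinity (a radial function), and $Z$ is tangent to all boundary strata near infinity. The slices $\{s=c\}$ with $c$ large, with the contact structure $\ker\lambda$, represent the ideal boundary $\partial_\infty M$. For a submanifold $S\subset M$ let $\mathcal N_S$ be the leaf space (with the quotient topology) of the null foliation $\ker(\iota_S^*d\lambda)$ and $\pi_S:S\to\mathcal N_S$ the projection; a function $g$ on $\mathcal N_S$ is smooth if $g\circ\pi_S$ is, and a section $\sigma$ of $\pi_S$ is smooth if $\sigma\circ\pi_S$ is. A closed embedded hypersurface $H\subset M$ (with corners) is *$\sigma$-sectorial* if (1) $Z$ is tangent to $H$ near infinity; (2) $H_\infty=\partial_\infty M\cap H$ is convex in $\partial_\infty M$, i.e. there is a contact vector field near $H_\infty$ transverse to it; (3) $\pi_H$ has a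 continuous section and each of its fibers is homeomorphic to $\mathbb R$. A collection $H_1,\dots,H_m$ of hypersurfaces is *clean coisotropic* if each is tangent to $Z$ near infinity, the $H_i$ intersect cleanly (any $k$ of them in a submanifold of codimension $k$) and the pairwise intersections are coisotropic. A corner $\delta$ of codimension $m\ge1$ is a connected component of the set of points of depth $m$. It is *$\sigma$-sectorial*, presented by $(H_i)$, if $H_1,\dots,H_m\subset\partial M$ is a clean coisotropic collection of $\sigma$-sectorial hypersurfaces whose intersection $C_\delta=H_1\cap\dots\cap H_m$ contains $\delta$, lies in the closure of the depth-$m$ stratum, and has contractible fibers of $\pi_{C_\delta}$. $(M,\lambda)$ is a *Liouville $\sigma$-sector* (possibly with corners) if it is a Liouville manifold with corners and each corner of each codimension $m\ge1$ (in particular each boundary face) is $\sigma$-sectorial. An *isomorphism* $(M,\lambda)\to(M',\lambda')$ of Liouville $\sigma$-sectors is a diffeomorphism $\psi:M\to M'$ of manifolds with corners with $\psi^*\lambda'=\lambda+df$ for some compactly supported smooth $f$; the structure of Liouville $\sigma$-sectors is the isomorphism class. **Theorem.** Let $(M,\lambda)$ be a Liouville $\sigma$-sector (possibly with corners), and let $\psi:M\to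 M$ be a diffeomorphism with $\psi^*\lambda=\lambda+df$ for a compactly supported smooth function $f:M\to\mathbb R$. Then $\psi$ is an automorphism of the structure of Liouville $\sigma$-sectors. Precisely: 1. $\psi$ and $\psi^{-1}$ are automorphisms of the Liouville $\sigma$-sector $(M,\lambda)$; moreover $(M,\psi^*\lambda)=(M,\lambda+df)$ is a Liouville $\sigma$-sector, and both $\psi$ and $\mathrm{id}_M$ are isomorphisms $(M,\psi^*\lambda)\to(M,\lambda)$. 2. $\psi^*d\lambda=d\lambda$, and $\psi$ maps the depth-$m$ stratum onto itself for every $m$. 3. A subset $H\subset M$ is a $\sigma$-sectorial hypersurface of $(M,\lambda)$ if and only if $\psi(H)$ is; and $(H_i)_{i=1}^m$ presents $\delta$ as a $\sigma$-sectorial corner of codimension $m$ if and only if $(\psi(H_i))_{i=1}^m$ so presents $\psi(\delta)$. 4. If $S$ is a $\sigma$-sectorial hypersurface, or the intersection $C_\delta$ of a collection presenting a $\sigma$-sectorial corner $\delta$, then $\psi|_S$ descends to a homeomorphism $[\psi]:\mathcal N_S\to\mathcal N_{\psi(S)}$ with $[\psi]\circ\pi_S=\pi_{\psi(S)}\circ\psi$,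 under which smooth functions correspond, and for every continuous (resp. smooth) section $\sigma$ of $\pi_S$ the map $\psi\circ\sigma\circ[\psi]^{-1}$ is a continuous (resp. smooth) section of $\pi_{\psi(S)}$. -/

import Mathlib

open Set Filter Topology
open scoped Manifold ContDiff

noncomputable section

namespace SigmaSector

/-! ## Manifolds with corners and differential forms of degree one

Manifolds with corners of dimension `2 n` are modelled on the quadrant `[0, ∞)^(2n)`; points of any
depth, interior points included, have charts of this kind. -/

/-- The model `[0, ∞)^(2n) ⊆ ℝ^(2n)` for manifolds with corners of dimension `2 n`. -/
abbrev corners (n : ℕ) :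
    ModelWithCorners ℝ (EuclideanSpace ℝ (Fin (2 * n))) (EuclideanQuadrant (2 * n)) :=
  modelWithCornersEuclideanQuadrant (2 * n)

variable {n : ℕ}
variable {M : Type*} [TopologicalSpace M] [ChartedSpace (EuclideanQuadrant (2 * n)) M]
variable {M' : Type*} [TopologicalSpace M'] [ChartedSpace (EuclideanQuadrant (2 * n)) M']

variable (n M) in
/-- A (not necessarily smooth) one-form on `M`. -/
abbrev OneForm : Type _ := ∀ x : M, TangentSpace (corners n) x →L[ℝ] ℝ

/-- The coordinate expression of a one-form in the preferred chart at `x₀`. -/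
def OneForm.inChart (lam : OneForm n M) (x₀ : M) (y : EuclideanSpace ℝ (Fin (2 * n))) :
    EuclideanSpace ℝ (Fin (2 * n)) →L[ℝ] ℝ :=
  (lam ((extChartAt (corners n) x₀).symm y)).comp
    (mfderivWithin 𝓘(ℝ, EuclideanSpace ℝ (Fin (2 * n))) (corners n)
      (extChartAt (corners n) x₀).symm (range (corners n)) y)

/-- Smoothness (up to boundary and corners) of a one-form. -/
def OneForm.IsSmooth (lam : OneForm n M) : Prop :=
  ∀ x₀ : M, ContDiffOn ℝ ∞ (lam.inChart x₀) (extChartAt (corners n) x₀).target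

/-- The exterior derivative `dλ` at `x`, computed in the preferred chart at `x`, which is the chart
that identifies `TangentSpace (corners n) x` with `ℝ^(2n)`. -/
def OneForm.d (lam : OneForm n M) (x : M) (v w : TangentSpace (corners n) x) : ℝ :=
  extDerivWithin
    (fun y => ContinuousAlternatingMap.ofSubsingleton ℝ (EuclideanSpace ℝ (Fin (2 * n))) ℝ
      (0 : Fin 1) (lam.inChart x y))
    (range (corners n)) (extChartAt (corners n) x x) ![v, w]

/-- The exact one-form `df`. -/
def differential (f : M → ℝ) : OneForm n M := fun x => mfderiv (corners n) 𝓘(ℝ, ℝ) f x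

/-- The pullback `ψ^* λ`. -/
def pullback (ψ : M → M') (lam : OneForm n M') : OneForm n M :=
  fun x => (lam (ψ x)).comp (mfderiv (corners n) (corners n) ψ x)

/-! ## Strata, corners and submanifolds -/

variable (n M) in
/-- The open stratum of depth `m`: the points with exactly `m` vanishing coordinates in some
smooth corner chart (equivalently, in all of them). -/
def stratum (m : ℕ) : Set M :=
  {x | ∃ e ∈ IsManifold.maximalAtlas (corners n) ∞ M, x ∈ e.source ∧
    {j : Fin (2 * n) | (e x).1 j = 0}.ncard = m}

/-- `δ` is a corner of codimension `m`: a connected component of the stratum of depth `m`. For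
`m = 1` these are the open boundary faces. -/
def IsCorner (n : ℕ) {M : Type*} [TopologicalSpace M] [ChartedSpace (EuclideanQuadrant (2 * n)) M]
    (m : ℕ) (δ : Set M) : Prop :=
  ∃ x ∈ stratum n M m, δ = connectedComponentIn (stratum n M m) x

/-- `S` is an embedded submanifold with corners of codimension `k`: near each of its points it is
given by fixing `k` of the coordinates of some smooth corner chart. A fixed coordinate equal to `0`
corresponds to a boundary face, a positive one to an interior slice. -/
def IsSubmanifold (n : ℕ) {M : Type*} [TopologicalSpace M]
    [ChartedSpace (EuclideanQuadrant (2 * n)) M] (k : ℕ) (S : Set M) : Prop :=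
  ∀ x ∈ S, ∃ e ∈ IsManifold.maximalAtlas (corners n) ∞ M, x ∈ e.source ∧
    ∃ J : Finset (Fin (2 * n)), J.card = k ∧
      ∀ y ∈ e.source, y ∈ S ↔ ∀ j ∈ J, (e y).1 j = (e x).1 j

/-- The tangent space `T_x S ⊆ T_x M` of a submanifold with corners `S`: the linear span of the
tangent cone of `S` at `x` (at boundary points of `S` the span is the full tangent space). -/
def tangent (n : ℕ) {M : Type*} [TopologicalSpace M] [ChartedSpace (EuclideanQuadrant (2 * n)) M]
    (S : Set M) (x : M) : Submodule ℝ (TangentSpace (corners n) x) :=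
  Submodule.span ℝ (tangentConeAt ℝ
    ((extChartAt (corners n) x).target ∩ (extChartAt (corners n) x).symm ⁻¹' S)
    (extChartAt (corners n) x x) : Set (EuclideanSpace ℝ (Fin (2 * n))))

/-- Smoothness of a map defined on a subset `S ⊆ M` with values in a manifold: it extends locally
to smooth maps on open subsets of `M`. -/
def SmoothOnSubset {E' H' N : Type*} [NormedAddCommGroup E'] [NormedSpace ℝ E']
    [TopologicalSpace H'] (J : ModelWithCorners ℝ E' H') [TopologicalSpace N] [ChartedSpace H' N]
    (n : ℕ) {M : Type*} [TopologicalSpace M] [ChartedSpace (EuclideanQuadrant (2 * n)) M]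
    (S : Set M) (g : S → N) : Prop :=
  ∀ x : S, ∃ U : Set M, IsOpen U ∧ (x : M) ∈ U ∧ ∃ G : M → N,
    ContMDiffOn (corners n) J ∞ G U ∧ ∀ y : S, (y : M) ∈ U → G y = g y

/-! ## Liouville manifolds with corners -/

/-- The form `dλ` is nondegenerate at every point, i.e. symplectic. -/
def OneForm.IsSymplectic (lam : OneForm n M) : Prop :=
  ∀ (x : M) (v : TangentSpace (corners n) x), (∀ w, lam.d x v w = 0) → v = 0

/-- The Liouville vector field `Z`, characterised by `dλ(Z, ·) = λ` when `dλ` is symplectic. -/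
def OneForm.Z (lam : OneForm n M) (x : M) : TangentSpace (corners n) x :=
  Classical.epsilon fun v => ∀ w, lam.d x v w = lam x w

/-- `s` is a radial function of the cylindrical end: a smooth exhaustion with `Z[s] = 1` near
infinity. Outside a compact set `Z = ∂/∂s`, and the level sets `{s = c}` for large `c` are
contact-type hypersurfaces transverse to `Z`, all identified with one another and with the ideal
boundary `∂_∞ M` by the flow of `Z`. -/
structure IsRadial (lam : OneForm n M) (s : M → ℝ) : Prop where
  smooth : ContMDiff (corners n) 𝓘(ℝ, ℝ) ∞ s
  exhaustion : ∀ c : ℝ, IsCompact (s ⁻¹' Iic c)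
  radial : ∃ K : Set M, IsCompact K ∧ ∀ x ∉ K, differential s x (lam.Z x) = 1

/-- Liouville manifolds with corners (of finite type): `dλ` is symplectic, there is a cylindrical
end on which the Liouville vector field is radial, and near infinity the Liouville vector field is
tangent to all boundary strata, so that the ideal boundary `∂_∞ M` is defined. -/
structure IsLiouville (lam : OneForm n M) : Prop where
  smooth : lam.IsSmooth
  symplectic : lam.IsSymplectic
  cylindrical : ∃ s : M → ℝ, IsRadial lam s
  tangent_strata : ∃ K : Set M, IsCompact K ∧
    ∀ x ∉ K, ∀ m : ℕ, x ∈ stratum n M m → lam.Z x ∈ tangent n (stratum n M m) x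

/-! ## The null foliation and its leaf space -/

/-- The null (characteristic) distribution `ker (ι_S^* dλ)` of a submanifold `S`. -/
def nullDistribution (lam : OneForm n M) (S : Set M) (x : M) :
    Set (TangentSpace (corners n) x) :=
  {v | v ∈ tangent n S x ∧ ∀ w ∈ tangent n S x, lam.d x v w = 0}

/-- `x` and `y` are joined by a smooth curve in `S` tangent to the null distribution. -/
def NullCurve (lam : OneForm n M) (S : Set M) (x y : S) : Prop :=
  ∃ γ : ℝ → M, ContMDiffOn 𝓘(ℝ, ℝ) (corners n) ∞ γ (Icc 0 1) ∧ γ 0 = x ∧ γ 1 = y ∧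
    ∀ t ∈ Icc (0 : ℝ) 1, γ t ∈ S ∧
      mfderivWithin 𝓘(ℝ, ℝ) (corners n) γ (Icc 0 1) t (1 : ℝ) ∈ nullDistribution lam S (γ t)

/-- Two points lie on the same leaf if they are joined by a piecewise smooth curve tangent to the
null distribution. -/
def leafSetoid (lam : OneForm n M) (S : Set M) : Setoid S := Relation.EqvGen.setoid (NullCurve lam S)

/-- The leaf space `𝒩_S` of the null foliation, with the quotient topology. -/
def LeafSpace (lam : OneForm n M) (S : Set M) : Type _ := Quotient (leafSetoid lam S)

instance (lam : OneForm n M) (S : Set M) : TopologicalSpace (LeafSpace lam S) :=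
  inferInstanceAs (TopologicalSpace (Quotient (leafSetoid lam S)))

/-- The canonical projection `π_S : S → 𝒩_S`. -/
def leafMap (lam : OneForm n M) (S : Set M) (x : S) : LeafSpace lam S :=
  Quotient.mk (leafSetoid lam S) x

/-- Continuous sections of the projection `π_S`. -/
def IsSection (lam : OneForm n M) (S : Set M) (σ : LeafSpace lam S → S) : Prop :=
  Continuous σ ∧ ∀ ℓ, leafMap lam S (σ ℓ) = ℓ

/-- Smooth functions on the leaf space, for the smooth structure that makes `π_S` a submersion. -/
def IsSmoothOnLeafSpace (lam : OneForm n M) (S : Set M) (g : LeafSpace lam S → ℝ) : Prop :=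
  SmoothOnSubset 𝓘(ℝ, ℝ) n S fun x => g (leafMap lam S x)

/-- Smooth sections of the projection `π_S`, for the same smooth structure. -/
def IsSmoothSection (lam : OneForm n M) (S : Set M) (σ : LeafSpace lam S → S) : Prop :=
  IsSection lam S σ ∧ SmoothOnSubset (corners n) n S fun x => (σ (leafMap lam S x) : M)

/-! ## Convexity at infinity and `σ`-sectorial hypersurfaces -/

variable [IsManifold (corners n) ∞ M] [IsManifold (corners n) ∞ M']

/-- `η`, a vector field on the open set `U` of `M`, restricts to a contact vector field of the
contact manifold `({s = c}, ker λ)` on `U ∩ {s = c}`: it is tangent to `{s = c}`, and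
`L_η λ = d(λ(η)) + dλ(η, ·)` is a multiple of `λ` on the tangent spaces of `{s = c}`. -/
structure IsContactField (lam : OneForm n M) (s : M → ℝ) (c : ℝ) (U : Set M)
    (η : ∀ x : M, TangentSpace (corners n) x) : Prop where
  smooth : ContMDiffOn (corners n) (corners n).tangent ∞
    (fun x => (⟨x, η x⟩ : TangentBundle (corners n) M)) U
  tangent : ∀ x ∈ U, s x = c → differential s x (η x) = 0
  contact : ∀ x ∈ U, s x = c → ∃ g : ℝ, ∀ w : TangentSpace (corners n) x,
    differential s x w = 0 →
      differential (fun y => lam y (η y)) x w + lam.d x (η x) w = g * lam x w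

/-- `H_∞ = ∂_∞ M ∩ H` is a convex hypersurface of the contact manifold `∂_∞ M`: on the slices
`{s = c}` representing `∂_∞ M` far out, some contact vector field defined near `H ∩ {s = c}` is
transverse to it. -/
def IsConvexAtInfinity (lam : OneForm n M) (H : Set M) : Prop :=
  ∃ s : M → ℝ, IsRadial lam s ∧ ∀ᶠ c : ℝ in atTop,
    ∃ (U : Set M) (η : ∀ x : M, TangentSpace (corners n) x),
      IsOpen U ∧ H ∩ s ⁻¹' {c} ⊆ U ∧ IsContactField lam s c U η ∧
      ∀ x ∈ H ∩ s ⁻¹' {c}, η x ∉ tangent n H x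

/-- `σ`-sectorial hypersurfaces. -/
structure IsSigmaSectorialHypersurface (lam : OneForm n M) (H : Set M) : Prop where
  closed : IsClosed H
  hypersurface : IsSubmanifold n 1 H
  tangent_at_infinity : ∃ K : Set M, IsCompact K ∧ ∀ x ∈ H, x ∉ K → lam.Z x ∈ tangent n H x
  convex_at_infinity : IsConvexAtInfinity lam H
  exists_section : ∃ σ : LeafSpace lam H → H, IsSection lam H σ
  fibers : ∀ ℓ : LeafSpace lam H, Nonempty ({x : H // leafMap lam H x = ℓ} ≃ₜ ℝ)

/-! ## Liouville `σ`-sectors with corners -/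

/-- The submanifold `S` is coisotropic: `(T_x S)^{dλ} ⊆ T_x S`. -/
def IsCoisotropic (lam : OneForm n M) (S : Set M) : Prop :=
  ∀ x ∈ S, ∀ v : TangentSpace (corners n) x,
    (∀ w ∈ tangent n S x, lam.d x v w = 0) → v ∈ tangent n S x

/-- Clean coisotropic collections of hypersurfaces. The hypersurfaces intersect cleanly, the
intersection of `k` of them having codimension `k`, and the pairwise intersections are
coisotropic. -/
structure IsCleanCoisotropic (lam : OneForm n M) {m : ℕ} (H : Fin m → Set M) : Prop where
  submanifold : ∀ I : Finset (Fin m), I.Nonempty → IsSubmanifold n I.card (⋂ i ∈ I, H i)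
  clean : ∀ I : Finset (Fin m), I.Nonempty → ∀ x ∈ ⋂ i ∈ I, H i,
    tangent n (⋂ i ∈ I, H i) x = ⨅ i ∈ I, tangent n (H i) x
  cylindrical : ∀ i, ∃ K : Set M, IsCompact K ∧
    ∀ x ∈ H i, x ∉ K → lam.Z x ∈ tangent n (H i) x
  coisotropic : ∀ i j, i ≠ j → IsCoisotropic lam (H i ∩ H j)

/-- The collection `H` presents the corner `δ` of codimension `m` as a `σ`-sectorial corner
`C_δ = H₁ ∩ ⋯ ∩ H_m`. -/
structure IsSigmaSectorialCorner (lam : OneForm n M) (m : ℕ) (δ : Set M) (H : Fin m → Set M) :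
    Prop where
  corner : IsCorner n m δ
  sectorial : ∀ i, IsSigmaSectorialHypersurface lam (H i)
  boundary : ∀ i, H i ⊆ (corners n).boundary M
  collection : IsCleanCoisotropic lam H
  subset : δ ⊆ ⋂ i, H i
  subset_closure : ⋂ i, H i ⊆ closure (stratum n M m)
  fibers : ∀ ℓ : LeafSpace lam (⋂ i, H i),
    ContractibleSpace {x : (⋂ i, H i : Set M) // leafMap lam (⋂ i, H i) x = ℓ}

/-- Liouville `σ`-sectors (possibly with corners): Liouville manifolds with corners all of whose
corners, boundary faces included, are `σ`-sectorial. -/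
structure IsSigmaSector (lam : OneForm n M) : Prop where
  liouville : IsLiouville lam
  sectorial : ∀ m : ℕ, 1 ≤ m → ∀ δ : Set M, IsCorner n m δ →
    ∃ H : Fin m → Set M, IsSigmaSectorialCorner lam m δ H

/-- `ψ : (M, λ) → (M', λ')` is an isomorphism of Liouville `σ`-sectors. The structure of Liouville
`σ`-sectors is the isomorphism class for this notion. -/
structure IsSigmaSectorIso (lam : OneForm n M) (lam' : OneForm n M')
    (ψ : M ≃ₘ^∞⟮corners n, corners n⟯ M') : Prop where
  source : IsSigmaSector lam
  target : IsSigmaSector lam'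
  exact : ∃ f : M → ℝ, ContMDiff (corners n) 𝓘(ℝ, ℝ) ∞ f ∧ HasCompactSupport f ∧
    pullback ψ lam' = lam + differential f

/-- `ψ`, restricted to `S`, descends to a diffeomorphism `[ψ] : 𝒩_S → 𝒩_{ψ(S)}` of leaf spaces with
`[ψ] ∘ π_S = π_{ψ(S)} ∘ ψ`, and every section `σ` of `π_S` induces the section
`ψ ∘ σ ∘ [ψ]⁻¹` of `π_{ψ(S)}`, smooth if `σ` is smooth. -/
def DescendsToLeafSpace (lam : OneForm n M) (ψ : M → M) (S : Set M) : Prop :=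
  ∃ Ψ : LeafSpace lam S ≃ₜ LeafSpace lam (ψ '' S),
    (∀ x : S, Ψ (leafMap lam S x) = leafMap lam (ψ '' S) ⟨ψ x, mem_image_of_mem ψ x.2⟩) ∧
    (∀ g : LeafSpace lam (ψ '' S) → ℝ,
      IsSmoothOnLeafSpace lam (ψ '' S) g ↔ IsSmoothOnLeafSpace lam S (g ∘ Ψ)) ∧
    ∀ σ : LeafSpace lam S → S,
      (IsSection lam S σ → IsSection lam (ψ '' S)
        fun ℓ => ⟨ψ (σ (Ψ.symm ℓ)), mem_image_of_mem ψ (σ (Ψ.symm ℓ)).2⟩) ∧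
      (IsSmoothSection lam S σ → IsSmoothSection lam (ψ '' S)
        fun ℓ => ⟨ψ (σ (Ψ.symm ℓ)), mem_image_of_mem ψ (σ (Ψ.symm ℓ)).2⟩)

end SigmaSector

end

namespace SigmaSector

section Forms

variable {n : ℕ}
variable {M : Type*} [TopologicalSpace M] [ChartedSpace (EuclideanQuadrant (2 * n)) M]
variable {M' : Type*} [TopologicalSpace M'] [ChartedSpace (EuclideanQuadrant (2 * n)) M']

/-! ## The exterior derivative of a one-form -/

/-! A σ-sector is described by the smooth structure of `M`, by `dλ`, and by `λ` outside a compact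
set; a diffeomorphism with `ψ^*λ' = λ + df`, `f` compactly supported, respects all three. Since `d`
is natural and `d(df) = 0`, it is a symplectomorphism (`isSymplecto_of_pullback_eq`, resting on
`d_pullback` and `d_differential`). Since `df` vanishes off the support of `f`, it satisfies `ψ^*λ'
= λ` near infinity (`isStrictAtInfinity_of_pullback_eq`), and there the Liouville fields correspond,
because `Z` is determined by `dλ(Z, ·) = λ` (`IsSymplecto.Z_eq`).

Each clause of the definition then moves along `ψ`. Charts transport by composition with the inverse
(`symm_trans_mem_maximalAtlas`), hence so do strata, corners and submanifolds; tangent spaces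
transport by `mfderiv_mem_tangent_image_iff`. The null foliation depends only on `dλ` and tangent
spaces, so leaf spaces, fibers and sections correspond (`IsSymplecto.leafHomeomorph`). Radial
functions become `s ∘ ψ⁻¹`, and contact fields are pushed forward on slices lying beyond the compact
set where `λ` changes (`IsSymplecto.isConvexAtInfinity`).

The transport lemmas allow two different forms on source and target. They therefore apply to `ψ`, to
`ψ⁻¹` (for the converse implications), and to the identity from `(M, λ)` to `(M, λ + df)`, which
shows that the modified form again defines a σ-sector. -/

theorem OneForm.d_eq (lam : OneForm n M) (x : M) (v w : TangentSpace (corners n) x) :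
    lam.d x v w = fderivWithin ℝ (fun y => ContinuousAlternatingMap.ofSubsingleton ℝ
        (EuclideanSpace ℝ (Fin (2 * n))) ℝ (0 : Fin 1) (lam.inChart x y)) (range (corners n))
        (extChartAt (corners n) x x) v ![w] -
      fderivWithin ℝ (fun y => ContinuousAlternatingMap.ofSubsingleton ℝ
        (EuclideanSpace ℝ (Fin (2 * n))) ℝ (0 : Fin 1) (lam.inChart x y)) (range (corners n))
        (extChartAt (corners n) x x) w ![v] := by
  rw [OneForm.d, extDerivWithin, ContinuousAlternatingMap.alternatizeUncurryFin_apply,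
    Fin.sum_univ_two]
  have h1 : Fin.removeNth (α := fun _ : Fin 2 => EuclideanSpace ℝ (Fin (2 * n))) 0 ![v, w] =
      ![w] := by
    funext i; fin_cases i; rfl
  have h2 : Fin.removeNth (α := fun _ : Fin 2 => EuclideanSpace ℝ (Fin (2 * n))) 1 ![v, w] =
      ![v] := by
    funext i; fin_cases i; rfl
  rw [h1, h2, sub_eq_add_neg, Fin.val_zero, Fin.val_one, pow_zero, pow_one, one_smul,
    neg_one_smul]
  rfl

theorem OneForm.d_swap (lam : OneForm n M) (x : M) (v w : TangentSpace (corners n) x) :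
    lam.d x v w = -lam.d x w v := by
  rw [d_eq, d_eq, neg_sub]

theorem OneForm.d_add_right (lam : OneForm n M) (x : M) (v w w' : TangentSpace (corners n) x) :
    lam.d x v (w + w') = lam.d x v w + lam.d x v w' := by
  have h (u : EuclideanSpace ℝ (Fin (2 * n))) : Function.update ![v, w] 1 u = ![v, u] := by
    funext i; fin_cases i <;> rfl
  have := (extDerivWithin
    (fun y => ContinuousAlternatingMap.ofSubsingleton ℝ (EuclideanSpace ℝ (Fin (2 * n))) ℝ
      (0 : Fin 1) (lam.inChart x y))
    (range (corners n)) (extChartAt (corners n) x x)).map_update_add ![v, w] 1 w w'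
  erw [h, h, h] at this
  exact this

theorem OneForm.d_smul_right (lam : OneForm n M) (x : M) (v w : TangentSpace (corners n) x)
    (c : ℝ) : lam.d x v (c • w) = c * lam.d x v w := by
  have h (u : EuclideanSpace ℝ (Fin (2 * n))) : Function.update ![v, w] 1 u = ![v, u] := by
    funext i; fin_cases i <;> rfl
  have := (extDerivWithin
    (fun y => ContinuousAlternatingMap.ofSubsingleton ℝ (EuclideanSpace ℝ (Fin (2 * n))) ℝ
      (0 : Fin 1) (lam.inChart x y))
    (range (corners n)) (extChartAt (corners n) x x)).map_update_smul ![v, w] 1 c w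
  erw [h, h] at this
  exact this

/-- The exterior derivative of a one-form as a bilinear form. -/
noncomputable def OneForm.dBilin (lam : OneForm n M) (x : M) :
    TangentSpace (corners n) x →ₗ[ℝ] TangentSpace (corners n) x →ₗ[ℝ] ℝ :=
  LinearMap.mk₂ ℝ (fun v w => lam.d x v w)
    (fun v v' w => by rw [lam.d_swap, lam.d_add_right, lam.d_swap x v, lam.d_swap x v']; ring)
    (fun c v w => by rw [lam.d_swap, lam.d_smul_right, lam.d_swap x v]; simp)
    (fun v w w' => lam.d_add_right x v w w')
    (fun c v w => lam.d_smul_right x v w c)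

/-- Nondegeneracy makes `v ↦ dλ(v, ·)` injective into the dual space, hence bijective by equality of
dimensions. This gives meaning to `Z`, which is defined by a choice operator. -/
theorem OneForm.IsSymplectic.existsUnique {lam : OneForm n M} (h : lam.IsSymplectic) (x : M) :
    ∃! v : TangentSpace (corners n) x, ∀ w, lam.d x v w = lam x w := by
  have hinj : Function.Injective (lam.dBilin x) := by
    rw [injective_iff_map_eq_zero]
    intro v hv
    exact h x v fun w => LinearMap.congr_fun hv w
  have : FiniteDimensional ℝ (TangentSpace (corners n) x) :=
    inferInstanceAs (FiniteDimensional ℝ (EuclideanSpace ℝ (Fin (2 * n))))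
  have hsurj : Function.Surjective (lam.dBilin x) :=
    (LinearMap.injective_iff_surjective_of_finrank_eq_finrank
      Subspace.dual_finrank_eq.symm).1 hinj
  obtain ⟨v, hv⟩ := hsurj (lam x).toLinearMap
  refine ⟨v, fun w => LinearMap.congr_fun hv w, fun v' hv' => hinj ?_⟩
  rw [hv]
  ext1 w
  exact hv' w

theorem OneForm.IsSymplectic.d_Z {lam : OneForm n M} (h : lam.IsSymplectic) (x : M)
    (w : TangentSpace (corners n) x) : lam.d x (lam.Z x) w = lam x w :=
  Classical.epsilon_spec (p := fun v => ∀ w, lam.d x v w = lam x w)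
    (h.existsUnique x).exists w

theorem OneForm.IsSymplectic.eq_Z {lam : OneForm n M} (h : lam.IsSymplectic) {x : M}
    {v : TangentSpace (corners n) x} (hv : ∀ w, lam.d x v w = lam x w) : v = lam.Z x :=
  (h.existsUnique x).unique hv (h.d_Z x)

theorem OneForm.IsSmooth.add {lam mu : OneForm n M} (hl : lam.IsSmooth) (hm : mu.IsSmooth) :
    (lam + mu).IsSmooth := fun x =>
  ((hl x).add (hm x)).congr fun y _ => by
    simp only [OneForm.inChart, Pi.add_apply]
    exact ContinuousLinearMap.add_comp _ _ _

/-- Smoothness is imposed on the chart target, whereas `d` differentiates within the range of the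
model; the target is a neighbourhood of the base point within that range. -/
theorem OneForm.IsSmooth.differentiableWithinAt {lam : OneForm n M} (hl : lam.IsSmooth) (x : M) :
    DifferentiableWithinAt ℝ (fun y => ContinuousAlternatingMap.ofSubsingleton ℝ
      (EuclideanSpace ℝ (Fin (2 * n))) ℝ (0 : Fin 1) (lam.inChart x y)) (range (corners n))
      (extChartAt (corners n) x x) :=
  (ContinuousAlternatingMap.ofSubsingletonLIE (𝕜 := ℝ) (E := EuclideanSpace ℝ (Fin (2 * n)))
    (F := ℝ) (0 : Fin 1)).differentiable.differentiableAt.comp_differentiableWithinAt _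
    (((hl x _ (mem_extChartAt_target x)).differentiableWithinAt (by simp)).mono_of_mem_nhdsWithin
      (extChartAt_target_mem_nhdsWithin x))

theorem OneForm.d_add {lam mu : OneForm n M} (hl : lam.IsSmooth) (hm : mu.IsSmooth) (x : M)
    (v w : TangentSpace (corners n) x) : (lam + mu).d x v w = lam.d x v w + mu.d x v w := by
  have h := extDerivWithin_add (corners n).uniqueDiffWithinAt_image
    (hl.differentiableWithinAt x) (hm.differentiableWithinAt x)
  have h' := congrArg (fun A => A ![v, w]) h
  refine Eq.trans ?_ h'
  rw [OneForm.d]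
  congr 2

/-! ## Coordinate expressions of maps -/

/-- Maps with the same germ share value and derivative at `y`. The covectors at the two image points
have different types, so they are compared in the common model space. -/
theorem OneForm.comp_mfderivWithin_congr (lam : OneForm n M')
    {F G : EuclideanSpace ℝ (Fin (2 * n)) → M'} {s : Set (EuclideanSpace ℝ (Fin (2 * n)))}
    {y : EuclideanSpace ℝ (Fin (2 * n))} (h : F =ᶠ[𝓝[s] y] G) (hy : y ∈ s) :
    (lam (F y)).comp (mfderivWithin 𝓘(ℝ, EuclideanSpace ℝ (Fin (2 * n))) (corners n) F s y) =
      (lam (G y)).comp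
        (mfderivWithin 𝓘(ℝ, EuclideanSpace ℝ (Fin (2 * n))) (corners n) G s y) := by
  have h1 := h.mfderivWithin_eq_of_mem (I := 𝓘(ℝ, EuclideanSpace ℝ (Fin (2 * n))))
    (I' := corners n) hy
  have h2 : ∀ p q : M', p = q → ((lam p : EuclideanSpace ℝ (Fin (2 * n)) →L[ℝ] ℝ)) = lam q := by
    rintro p _ rfl; rfl
  exact congrArg₂ (fun (A : EuclideanSpace ℝ (Fin (2 * n)) →L[ℝ] ℝ)
    (B : EuclideanSpace ℝ (Fin (2 * n)) →L[ℝ] EuclideanSpace ℝ (Fin (2 * n))) => A.comp B)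
    (h2 _ _ (h.eq_of_nhdsWithin hy)) h1

theorem contDiffWithinAt_writtenInExtChartAt {ψ : M → M'}
    (hψ : ContMDiff (corners n) (corners n) ∞ ψ) (x : M) :
    ContDiffWithinAt ℝ ∞ (writtenInExtChartAt (corners n) (corners n) x ψ) (range (corners n))
      (extChartAt (corners n) x x) := by
  simpa using (contMDiffAt_iff.1 (hψ x)).2

theorem writtenInExtChartAt_self (ψ : M → M') (x : M) :
    writtenInExtChartAt (corners n) (corners n) x ψ (extChartAt (corners n) x x) =
      extChartAt (corners n) (ψ x) (ψ x) := by
  simp [writtenInExtChartAt]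

theorem mfderiv_eq_fderivWithin {ψ : M → M'} (hψ : ContMDiff (corners n) (corners n) ∞ ψ)
    (x : M) : mfderiv (corners n) (corners n) ψ x =
      fderivWithin ℝ (writtenInExtChartAt (corners n) (corners n) x ψ) (range (corners n))
        (extChartAt (corners n) x x) :=
  (hψ.mdifferentiableAt (by simp)).mfderiv

/-- Near the base point, `ψ` can be expressed in the preferred charts. -/
theorem eventually_mem_charts {ψ : M → M'} (hψ : Continuous ψ) (x : M) :
    ∀ᶠ y in 𝓝[range (corners n)] (extChartAt (corners n) x x),
      y ∈ (extChartAt (corners n) x).target ∧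
        ψ ((extChartAt (corners n) x).symm y) ∈ (extChartAt (corners n) (ψ x)).source := by
  refine Filter.inter_mem (extChartAt_target_mem_nhdsWithin x) ?_
  have h1 : Tendsto (ψ ∘ (extChartAt (corners n) x).symm)
      (𝓝 (extChartAt (corners n) x x)) (𝓝 (ψ x)) := by
    have := hψ.continuousAt.comp (continuousAt_extChartAt_symm (I := corners n) x)
    simpa [ContinuousAt] using this
  exact (h1.mono_left nhdsWithin_le_nhds).eventually (extChartAt_source_mem_nhds (ψ x))

/-! ## Exact one-forms -/

variable [IsManifold (corners n) ∞ M] [IsManifold (corners n) ∞ M']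

theorem inChart_differential {f : M → ℝ} (hf : ContMDiff (corners n) 𝓘(ℝ, ℝ) ∞ f) (x : M)
    {y : EuclideanSpace ℝ (Fin (2 * n))} (hy : y ∈ (extChartAt (corners n) x).target) :
    (differential f).inChart x y =
      fderivWithin ℝ (f ∘ (extChartAt (corners n) x).symm) (range (corners n)) y := by
  have : IsManifold (corners n) 1 M := .of_le (n := ∞) (by simp)
  rw [← mfderivWithin_eq_fderivWithin]
  exact (mfderiv_comp_mfderivWithin y (hf.mdifferentiableAt (by simp))
    (mdifferentiableWithinAt_extChartAt_symm hy)
    ((corners n).uniqueDiffOn _ (extChartAt_target_subset_range x hy)).uniqueMDiffWithinAt).symm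

theorem minSmoothness_two_le_infty : minSmoothness ℝ 2 ≤ (∞ : ℕ∞ω) := by
  rw [minSmoothness_of_isRCLikeNormedField]
  exact WithTop.coe_le_coe.2 le_top

theorem contDiffOn_comp_extChartAt_symm {f : M → ℝ} (hf : ContMDiff (corners n) 𝓘(ℝ, ℝ) ∞ f)
    (x : M) : ContDiffOn ℝ ∞ (f ∘ (extChartAt (corners n) x).symm)
      (extChartAt (corners n) x).target :=
  contMDiffOn_iff_contDiffOn.1 (hf.comp_contMDiffOn (contMDiffOn_extChartAt_symm x))

theorem contDiffWithinAt_comp_extChartAt_symm {f : M → ℝ}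
    (hf : ContMDiff (corners n) 𝓘(ℝ, ℝ) ∞ f) (x : M) {y : EuclideanSpace ℝ (Fin (2 * n))}
    (hy : y ∈ (extChartAt (corners n) x).target) :
    ContDiffWithinAt ℝ ∞ (f ∘ (extChartAt (corners n) x).symm) (range (corners n)) y :=
  (contDiffOn_comp_extChartAt_symm hf x y hy).mono_of_mem_nhdsWithin
    (extChartAt_target_mem_nhdsWithin_of_mem hy)

theorem isSmooth_differential {f : M → ℝ} (hf : ContMDiff (corners n) 𝓘(ℝ, ℝ) ∞ f) :
    (differential f : OneForm n M).IsSmooth := by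
  intro x y hy
  refine ContDiffWithinAt.congr (f := fderivWithin ℝ (f ∘ (extChartAt (corners n) x).symm)
    (range (corners n))) ?_ (fun z hz => inChart_differential hf x hz)
    (inChart_differential hf x hy)
  exact ((contDiffWithinAt_comp_extChartAt_symm hf x hy).fderivWithin_right (m := ∞)
    (corners n).uniqueDiffOn (by simp) (extChartAt_target_subset_range x hy)).mono
    (extChartAt_target_subset_range x)

/-- This is `d² = 0` in the chart, with `f` read as a form of degree zero. Symmetry of second
derivatives survives at boundary and corner points because the quadrant lies in the closure of its
interior. -/
theorem d_differential {f : M → ℝ} (hf : ContMDiff (corners n) 𝓘(ℝ, ℝ) ∞ f) (x : M)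
    (v w : TangentSpace (corners n) x) : (differential f).d x v w = 0 := by
  have hx := mem_extChartAt_target (I := corners n) x
  have hr := extChartAt_target_subset_range (I := corners n) x hx
  have hud := (corners n).uniqueDiffOn
  have hc : ContDiffWithinAt ℝ ∞ (fun y => ContinuousAlternatingMap.constOfIsEmpty ℝ
      (EuclideanSpace ℝ (Fin (2 * n))) (Fin 0) ((f ∘ (extChartAt (corners n) x).symm) y))
      (range (corners n)) (extChartAt (corners n) x x) :=
    (ContinuousAlternatingMap.constOfIsEmptyLIE ℝ (EuclideanSpace ℝ (Fin (2 * n))) ℝ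
      (Fin 0)).contDiff.comp_contDiffWithinAt (contDiffWithinAt_comp_extChartAt_symm hf x hx)
  have h := extDerivWithin_extDerivWithin_apply hc minSmoothness_two_le_infty hud
    ((corners n).range_subset_closure_interior hr) hr
  have h' := congrArg (fun A => A ![v, w]) h
  refine Eq.trans ?_ h'
  rw [OneForm.d]
  congr 1
  refine Filter.EventuallyEq.extDerivWithin_eq_of_mem ?_ hr
  filter_upwards [extChartAt_target_mem_nhdsWithin (I := corners n) x] with y hy
  rw [extDerivWithin_constOfIsEmpty _ (hud y (extChartAt_target_subset_range x hy)),
    inChart_differential hf x hy]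

/-! ## Pullbacks -/

/-- Near the base point, `ψ` after the inverse chart equals the inverse chart at `ψ x` after the
coordinate expression of `ψ`. Applying the chain rule to both factorizations gives the formula. -/
theorem inChart_pullback {ψ : M → M'} (hψ : ContMDiff (corners n) (corners n) ∞ ψ)
    (lam : OneForm n M') (x : M) :
    ∀ᶠ y in 𝓝[range (corners n)] (extChartAt (corners n) x x),
      (pullback ψ lam).inChart x y =
        (lam.inChart (ψ x) (writtenInExtChartAt (corners n) (corners n) x ψ y)).comp
          (fderivWithin ℝ (writtenInExtChartAt (corners n) (corners n) x ψ)
            (range (corners n)) y) := by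
  have : IsManifold (corners n) 1 M := .of_le (n := ∞) (by simp)
  have : IsManifold (corners n) 1 M' := .of_le (n := ∞) (by simp)
  have hd : ∀ᶠ y in 𝓝[range (corners n)] (extChartAt (corners n) x x),
      ContDiffWithinAt ℝ 1 (writtenInExtChartAt (corners n) (corners n) x ψ)
        (range (corners n)) y := by
    have := ((contDiffWithinAt_writtenInExtChartAt hψ x).of_le
      (m := 1) (by simp)).eventually (by simp)
    rwa [insert_eq_of_mem (extChartAt_target_subset_range x (mem_extChartAt_target x))] at this
  -- The iterated form of the chart condition makes it hold on a neighbourhood of `y`, as needed to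
  -- compare derivatives at `y`.
  filter_upwards [eventually_mem_charts hψ.continuous x,
    eventually_eventually_nhdsWithin.2 (eventually_mem_charts hψ.continuous x), hd]
    with y hy hy' hyd
  have hyr := extChartAt_target_subset_range x hy.1
  have hu : UniqueMDiffWithinAt 𝓘(ℝ, EuclideanSpace ℝ (Fin (2 * n))) (range (corners n)) y :=
    ((corners n).uniqueDiffOn y hyr).uniqueMDiffWithinAt
  have e1 := mfderiv_comp_mfderivWithin (I := 𝓘(ℝ, EuclideanSpace ℝ (Fin (2 * n))))
    (I' := corners n) (I'' := corners n) y (hψ.mdifferentiableAt (by simp))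
    (mdifferentiableWithinAt_extChartAt_symm hy.1) hu
  have hΨ : writtenInExtChartAt (corners n) (corners n) x ψ y ∈
      (extChartAt (corners n) (ψ x)).target := (extChartAt (corners n) (ψ x)).map_source hy.2
  have e2 := mfderivWithin_comp (I := 𝓘(ℝ, EuclideanSpace ℝ (Fin (2 * n))))
    (I' := 𝓘(ℝ, EuclideanSpace ℝ (Fin (2 * n)))) (I'' := corners n) y
    (mdifferentiableWithinAt_extChartAt_symm hΨ)
    (hyd.differentiableWithinAt one_ne_zero).mdifferentiableWithinAt
    (fun z _ => mem_range_self _) hu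
  have h := lam.comp_mfderivWithin_congr (s := range (corners n)) (y := y)
    (F := ψ ∘ (extChartAt (corners n) x).symm)
    (G := (extChartAt (corners n) (ψ x)).symm ∘ writtenInExtChartAt (corners n) (corners n) x ψ)
    (by
      filter_upwards [hy'] with z hz
      exact ((extChartAt (corners n) (ψ x)).left_inv hz.2).symm) hyr
  rw [e1, e2, mfderivWithin_eq_fderivWithin] at h
  exact h

/-- Both sides are computed in the preferred charts at `x` and `ψ x`, where `mfderiv` is the
derivative of the coordinate expression, so naturality of `d` on Euclidean space suffices. -/
theorem d_pullback {ψ : M → M'} (hψ : ContMDiff (corners n) (corners n) ∞ ψ)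
    {lam : OneForm n M'} (hl : lam.IsSmooth) (x : M) (v w : TangentSpace (corners n) x) :
    (pullback ψ lam).d x v w = lam.d (ψ x) (mfderiv (corners n) (corners n) ψ x v)
      (mfderiv (corners n) (corners n) ψ x w) := by
  have hr := extChartAt_target_subset_range (I := corners n) x (mem_extChartAt_target x)
  have hω := hl.differentiableWithinAt (ψ x)
  rw [← writtenInExtChartAt_self ψ x] at hω
  have h := extDerivWithin_pullback hω (contDiffWithinAt_writtenInExtChartAt hψ x)
    minSmoothness_two_le_infty (corners n).uniqueDiffOn
    ((corners n).range_subset_closure_interior hr) hr (fun z _ => mem_range_self _)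
  have h' := congrArg (fun A => A ![v, w]) h
  rw [mfderiv_eq_fderivWithin hψ, OneForm.d, OneForm.d, ← writtenInExtChartAt_self ψ x]
  refine Eq.trans ?_ (h'.trans ?_)
  · congr 1
    refine Filter.EventuallyEq.extDerivWithin_eq_of_mem ?_ hr
    filter_upwards [inChart_pullback hψ lam x] with y hy
    rw [hy]
    rfl
  · rw [ContinuousAlternatingMap.compContinuousLinearMap_apply]
    congr 1
    funext i
    fin_cases i <;> rfl

end Forms

section Diffeomorphisms

variable {n : ℕ}
variable {M : Type*} [TopologicalSpace M] [ChartedSpace (EuclideanQuadrant (2 * n)) M]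
variable {M' : Type*} [TopologicalSpace M'] [ChartedSpace (EuclideanQuadrant (2 * n)) M']

/-! ## Differentials of diffeomorphisms -/

theorem mfderiv_symm_mfderiv (ψ : M ≃ₘ^∞⟮corners n, corners n⟯ M') (x : M)
    (v : TangentSpace (corners n) x) :
    mfderiv (corners n) (corners n) ψ.symm (ψ x) (mfderiv (corners n) (corners n) ψ x v) = v := by
  have h := mfderiv_comp_apply x (ψ.symm.mdifferentiable (by simp) (ψ x))
    (ψ.mdifferentiable (by simp) x) v
  have h' : ψ.symm ∘ ψ = id := funext ψ.symm_apply_apply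
  rw [h', mfderiv_id] at h
  exact h.symm

theorem mfderiv_mfderiv_symm (ψ : M ≃ₘ^∞⟮corners n, corners n⟯ M') (x : M)
    (w : TangentSpace (corners n) (ψ x)) :
    mfderiv (corners n) (corners n) ψ x (mfderiv (corners n) (corners n) ψ.symm (ψ x) w) = w := by
  have h := mfderiv_comp_apply_of_eq (ψ x) (ψ.mdifferentiable (by simp) x)
    (ψ.symm.mdifferentiable (by simp) (ψ x)) (ψ.symm_apply_apply x) w
  have h' : ψ ∘ ψ.symm = id := funext ψ.apply_symm_apply
  rw [h', mfderiv_id] at h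
  exact h.symm

/-- Lets every claim about tangent vectors at `ψ x` be checked on images of vectors at `x`. -/
theorem mfderiv_surjective (ψ : M ≃ₘ^∞⟮corners n, corners n⟯ M') (x : M) :
    Function.Surjective (mfderiv (corners n) (corners n) ψ x) :=
  fun w => ⟨_, mfderiv_mfderiv_symm ψ x w⟩

/-- If `h` is not differentiable at `ψ x`, neither is `h ∘ ψ` at `x`, and both derivatives take the
default value zero. Hence `λ(η)` can be transported in the contact condition without proving it
differentiable. -/
theorem differential_comp (ψ : M ≃ₘ^∞⟮corners n, corners n⟯ M') (h : M' → ℝ) (x : M)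
    (v : TangentSpace (corners n) x) :
    differential h (ψ x) (mfderiv (corners n) (corners n) ψ x v) = differential (h ∘ ψ) x v := by
  by_cases hd : MDifferentiableAt (corners n) 𝓘(ℝ, ℝ) h (ψ x)
  · exact (mfderiv_comp_apply x hd (ψ.mdifferentiable (by simp) x) v).symm
  · have hd' : ¬ MDifferentiableAt (corners n) 𝓘(ℝ, ℝ) (h ∘ ψ) x := by
      intro h2
      apply hd
      have h3 := h2.comp_of_eq (ψ x) (ψ.symm.mdifferentiable (by simp) (ψ x))
        (ψ.symm_apply_apply x)
      rwa [Function.comp_assoc, show ψ ∘ ψ.symm = id from funext ψ.apply_symm_apply] at h3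
    rw [differential, differential, mfderiv_zero_of_not_mdifferentiableAt hd,
      mfderiv_zero_of_not_mdifferentiableAt hd']
    rfl

theorem differential_comp_symm (ψ : M ≃ₘ^∞⟮corners n, corners n⟯ M') (s : M → ℝ) (x : M)
    (v : TangentSpace (corners n) x) :
    differential (s ∘ ψ.symm) (ψ x) (mfderiv (corners n) (corners n) ψ x v) =
      differential s x v := by
  rw [differential_comp, Function.comp_assoc, show ψ.symm ∘ ψ = id from
    funext ψ.symm_apply_apply, Function.comp_id]

/-! ## Strata, submanifolds and tangent spaces under diffeomorphisms -/

/-- A derivative maps tangent cones into tangent cones, and by linearity spans into spans. This is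
done in charts, where `ψ` maps `S` to `S'` only near the base point. -/
theorem mfderiv_mem_tangent {ψ : M → M'} (hψ : ContMDiff (corners n) (corners n) ∞ ψ)
    {S : Set M} {S' : Set M'} (hS : MapsTo ψ S S') {x : M} {v : TangentSpace (corners n) x}
    (hv : v ∈ tangent n S x) : mfderiv (corners n) (corners n) ψ x v ∈ tangent n S' (ψ x) := by
  set Ψ := writtenInExtChartAt (corners n) (corners n) x ψ
  set T := (extChartAt (corners n) x).target ∩ (extChartAt (corners n) x).symm ⁻¹' S
  set T' := (extChartAt (corners n) (ψ x)).target ∩ (extChartAt (corners n) (ψ x)).symm ⁻¹' S'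
  set D : EuclideanSpace ℝ (Fin (2 * n)) →L[ℝ] EuclideanSpace ℝ (Fin (2 * n)) :=
    fderivWithin ℝ Ψ (range (corners n)) (extChartAt (corners n) x x)
  have hD : HasFDerivWithinAt Ψ D (range (corners n)) (extChartAt (corners n) x x) :=
    ((contDiffWithinAt_writtenInExtChartAt hψ x).differentiableWithinAt
      (by simp)).hasFDerivWithinAt
  have hev : ∀ᶠ y in 𝓝[T] (extChartAt (corners n) x x), Ψ y ∈ T' := by
    have hTr : T ⊆ range (corners n) :=
      inter_subset_left.trans (extChartAt_target_subset_range x)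
    filter_upwards [nhdsWithin_mono _ hTr (eventually_mem_charts hψ.continuous x),
      self_mem_nhdsWithin] with y hy hyT
    refine ⟨(extChartAt (corners n) (ψ x)).map_source hy.2, ?_⟩
    have : (extChartAt (corners n) (ψ x)).symm (Ψ y) = ψ ((extChartAt (corners n) x).symm y) :=
      (extChartAt (corners n) (ψ x)).left_inv hy.2
    rw [mem_preimage, this]
    exact hS hyT.2
  have hcone : MapsTo D (tangentConeAt ℝ T (extChartAt (corners n) x x))
      (tangentConeAt ℝ T' (extChartAt (corners n) (ψ x) (ψ x))) := by
    intro u hu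
    -- The tangent cone is local, so `T` may be cut down to the points that `Ψ` sends into `T'`.
    have hu' : u ∈ tangentConeAt ℝ (T ∩ Ψ ⁻¹' T') (extChartAt (corners n) x x) := by
      refine tangentConeAt_mono_nhds ?_ hu
      exact le_of_eq (nhdsWithin_inter_of_mem' hev).symm
    have hm := (hD.mono (inter_subset_left.trans
      (inter_subset_left.trans (extChartAt_target_subset_range x)))).mapsTo_tangent_cone hu'
    rw [show Ψ _ = _ from writtenInExtChartAt_self ψ x] at hm
    exact tangentConeAt_mono (image_subset_iff.2 inter_subset_right) hm
  rw [mfderiv_eq_fderivWithin hψ]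
  have hle : Submodule.span ℝ (tangentConeAt ℝ T (extChartAt (corners n) x x)) ≤
      (Submodule.span ℝ (tangentConeAt ℝ T' (extChartAt (corners n) (ψ x) (ψ x)))).comap
        D.toLinearMap :=
    Submodule.span_le.2 fun u hu => Submodule.subset_span (hcone hu)
  exact hle hv

/-- All tangent spaces are the same model space, so a fixed vector can be moved along an equality of
points such as `ψ.symm (ψ x) = x`. `OneForm.d_congr` and `OneForm.apply_congr` serve the same
purpose. -/
theorem mem_tangent_congr {S : Set M} {x x' : M} (h : x = x')
    (v : EuclideanSpace ℝ (Fin (2 * n))) :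
    @Membership.mem (EuclideanSpace ℝ (Fin (2 * n)))
      (Submodule ℝ (EuclideanSpace ℝ (Fin (2 * n)))) _ (tangent n S x) v ↔
    @Membership.mem (EuclideanSpace ℝ (Fin (2 * n)))
      (Submodule ℝ (EuclideanSpace ℝ (Fin (2 * n)))) _ (tangent n S x') v := by
  subst h; rfl

theorem mfderiv_mem_tangent_image_iff (ψ : M ≃ₘ^∞⟮corners n, corners n⟯ M') {S : Set M} {x : M}
    {v : TangentSpace (corners n) x} :
    mfderiv (corners n) (corners n) ψ x v ∈ tangent n (ψ '' S) (ψ x) ↔ v ∈ tangent n S x := by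
  refine ⟨fun h => ?_, mfderiv_mem_tangent ψ.contMDiff (mapsTo_image ψ S)⟩
  have h' := mfderiv_mem_tangent (S' := S) ψ.symm.contMDiff
    (by rintro _ ⟨y, hy, rfl⟩; simpa using hy) h
  rw [mfderiv_symm_mfderiv] at h'
  exact (mem_tangent_congr (ψ.symm_apply_apply x) v).1 h'

variable [IsManifold (corners n) ∞ M] [IsManifold (corners n) ∞ M']

/-- Membership in the maximal atlas means smoothness in both directions, which composition with a
diffeomorphism preserves. The coordinates are unchanged, so depth and slice conditions carry over.
-/
theorem symm_trans_mem_maximalAtlas (ψ : M ≃ₘ^∞⟮corners n, corners n⟯ M')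
    {e : OpenPartialHomeomorph M (EuclideanQuadrant (2 * n))}
    (he : e ∈ IsManifold.maximalAtlas (corners n) ∞ M) :
    ψ.symm.toHomeomorph.transOpenPartialHomeomorph e ∈
      IsManifold.maximalAtlas (corners n) ∞ M' := by
  rw [IsManifold.mem_maximalAtlas_iff_contMDiffOn] at he ⊢
  exact ⟨he.1.comp ψ.symm.contMDiff.contMDiffOn fun _ hx => hx,
    ψ.contMDiff.comp_contMDiffOn he.2⟩

theorem image_stratum_subset (ψ : M ≃ₘ^∞⟮corners n, corners n⟯ M') (m : ℕ) :
    ψ '' stratum n M m ⊆ stratum n M' m := by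
  rintro _ ⟨x, ⟨e, he, hx, hm⟩, rfl⟩
  refine ⟨_, symm_trans_mem_maximalAtlas ψ he, ?_, ?_⟩
  · simpa using hx
  · simpa using hm

theorem image_stratum (ψ : M ≃ₘ^∞⟮corners n, corners n⟯ M') (m : ℕ) :
    ψ '' stratum n M m = stratum n M' m := by
  refine (image_stratum_subset ψ m).antisymm fun y hy => ?_
  exact ⟨ψ.symm y, image_stratum_subset ψ.symm m (mem_image_of_mem _ hy), by simp⟩

theorem IsCorner.image (ψ : M ≃ₘ^∞⟮corners n, corners n⟯ M') {m : ℕ} {δ : Set M}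
    (h : IsCorner n m δ) : IsCorner n m (ψ '' δ) := by
  obtain ⟨x, hx, rfl⟩ := h
  refine ⟨ψ x, image_stratum_subset ψ m (mem_image_of_mem _ hx), ?_⟩
  rw [← image_stratum ψ m]
  exact ψ.toHomeomorph.image_connectedComponentIn hx

theorem IsSubmanifold.image (ψ : M ≃ₘ^∞⟮corners n, corners n⟯ M') {k : ℕ} {S : Set M}
    (h : IsSubmanifold n k S) : IsSubmanifold n k (ψ '' S) := by
  rintro _ ⟨x, hx, rfl⟩
  obtain ⟨e, he, hxe, J, hJ, hS⟩ := h x hx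
  refine ⟨_, symm_trans_mem_maximalAtlas ψ he, by simpa using hxe, J, hJ, fun y hy => ?_⟩
  have := hS (ψ.symm y) (by simpa using hy)
  rw [ψ.image_eq_preimage_symm, mem_preimage, this]
  simp

end Diffeomorphisms

section Symplectomorphisms

variable {n : ℕ}
variable {M : Type*} [TopologicalSpace M] [ChartedSpace (EuclideanQuadrant (2 * n)) M]
variable {M' : Type*} [TopologicalSpace M'] [ChartedSpace (EuclideanQuadrant (2 * n)) M']

/-! ## Symplectomorphisms that are strict at infinity -/

/-- `ψ` is a symplectomorphism `(M, dλ) → (M', dλ')`. -/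
def IsSymplecto (lam : OneForm n M) (lam' : OneForm n M')
    (ψ : M ≃ₘ^∞⟮corners n, corners n⟯ M') : Prop :=
  ∀ (x : M) (v w : TangentSpace (corners n) x),
    lam'.d (ψ x) (mfderiv (corners n) (corners n) ψ x v) (mfderiv (corners n) (corners n) ψ x w) =
      lam.d x v w

/-- `ψ^* λ' = λ` outside of a compact set. -/
def IsStrictAtInfinity (lam : OneForm n M) (lam' : OneForm n M')
    (ψ : M ≃ₘ^∞⟮corners n, corners n⟯ M') : Prop :=
  ∃ K : Set M, IsCompact K ∧ ∀ x ∉ K, ∀ v,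
    lam' (ψ x) (mfderiv (corners n) (corners n) ψ x v) = lam x v

theorem OneForm.d_congr (lam : OneForm n M) {x x' : M} (h : x = x')
    (v w : EuclideanSpace ℝ (Fin (2 * n))) : lam.d x v w = lam.d x' v w := by
  subst h; rfl

theorem OneForm.apply_congr (lam : OneForm n M) {x x' : M} (h : x = x')
    (v : EuclideanSpace ℝ (Fin (2 * n))) :
    (lam x : EuclideanSpace ℝ (Fin (2 * n)) →L[ℝ] ℝ) v =
      (lam x' : EuclideanSpace ℝ (Fin (2 * n)) →L[ℝ] ℝ) v := by
  subst h; rfl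

variable {lam : OneForm n M} {lam' : OneForm n M'} {ψ : M ≃ₘ^∞⟮corners n, corners n⟯ M'}

theorem IsSymplecto.symm (h : IsSymplecto lam lam' ψ) : IsSymplecto lam' lam ψ.symm := by
  intro y v w
  obtain ⟨x, rfl⟩ := EquivLike.surjective ψ y
  obtain ⟨v, rfl⟩ := mfderiv_surjective ψ x v
  obtain ⟨w, rfl⟩ := mfderiv_surjective ψ x w
  rw [h, mfderiv_symm_mfderiv, mfderiv_symm_mfderiv]
  exact lam.d_congr (ψ.symm_apply_apply x) v w

theorem IsStrictAtInfinity.symm (h : IsStrictAtInfinity lam lam' ψ) :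
    IsStrictAtInfinity lam' lam ψ.symm := by
  obtain ⟨K, hK, h⟩ := h
  refine ⟨ψ '' K, hK.image ψ.continuous, fun y hy w => ?_⟩
  obtain ⟨x, rfl⟩ := EquivLike.surjective ψ y
  obtain ⟨w, rfl⟩ := mfderiv_surjective ψ x w
  rw [h x fun hx => hy (mem_image_of_mem _ hx), mfderiv_symm_mfderiv]
  exact lam.apply_congr (ψ.symm_apply_apply x) w

theorem IsSymplecto.isSymplectic (h : IsSymplecto lam lam' ψ) (hl : lam.IsSymplectic) :
    lam'.IsSymplectic := by
  intro y v hv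
  obtain ⟨x, rfl⟩ := EquivLike.surjective ψ y
  obtain ⟨v, rfl⟩ := mfderiv_surjective ψ x v
  rw [hl x v fun w => (h x v w).symm.trans (hv _), map_zero]

/-- The image of `Z` satisfies the equation that characterizes the Liouville field of `lam'`.
Equality of the one-forms is needed only at the point `x`. -/
theorem IsSymplecto.Z_eq (h : IsSymplecto lam lam' ψ) (hl : lam.IsSymplectic) {x : M}
    (hx : ∀ v, lam' (ψ x) (mfderiv (corners n) (corners n) ψ x v) = lam x v) :
    mfderiv (corners n) (corners n) ψ x (lam.Z x) = lam'.Z (ψ x) := by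
  refine (h.isSymplectic hl).eq_Z fun w => ?_
  obtain ⟨w, rfl⟩ := mfderiv_surjective ψ x w
  rw [h, hx, hl.d_Z]

/-- Near infinity the Liouville vector fields correspond. -/
theorem IsSymplecto.exists_Z_eq (h : IsSymplecto lam lam' ψ)
    (h' : IsStrictAtInfinity lam lam' ψ) (hl : lam.IsSymplectic) : ∃ K : Set M, IsCompact K ∧
      ∀ x ∉ K, mfderiv (corners n) (corners n) ψ x (lam.Z x) = lam'.Z (ψ x) := by
  obtain ⟨K, hK, h'⟩ := h'
  exact ⟨K, hK, fun x hx => h.Z_eq hl (h' x hx)⟩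

/-- Near infinity, tangency of the Liouville vector field to a family of subsets is preserved. -/
theorem IsSymplecto.Z_mem_tangent_image (h : IsSymplecto lam lam' ψ)
    (h' : IsStrictAtInfinity lam lam' ψ) (hl : lam.IsSymplectic) {ι : Sort*} {S : ι → Set M}
    (hS : ∃ K : Set M, IsCompact K ∧ ∀ x ∉ K, ∀ i, x ∈ S i → lam.Z x ∈ tangent n (S i) x) :
    ∃ K : Set M', IsCompact K ∧
      ∀ y ∉ K, ∀ i, y ∈ ψ '' S i → lam'.Z y ∈ tangent n (ψ '' S i) y := by
  obtain ⟨K, hK, hS⟩ := hS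
  obtain ⟨L, hL, hZ⟩ := h.exists_Z_eq h' hl
  refine ⟨ψ '' (K ∪ L), (hK.union hL).image ψ.continuous, ?_⟩
  rintro _ hy i ⟨x, hx, rfl⟩
  rw [(EquivLike.injective ψ).mem_set_image, mem_union, not_or] at hy
  rw [← hZ x hy.2, mfderiv_mem_tangent_image_iff]
  exact hS x hy.1 i hx

/-- Sublevel sets of `s ∘ ψ⁻¹` are images of compact sets, and outside a compact set its derivative
along `Z` is that of `s`, because the Liouville fields correspond there. -/
theorem IsSymplecto.isRadial (h : IsSymplecto lam lam' ψ)
    (h' : IsStrictAtInfinity lam lam' ψ) (hl : lam.IsSymplectic) {s : M → ℝ}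
    (hs : IsRadial lam s) : IsRadial lam' (s ∘ ψ.symm) := by
  refine ⟨hs.smooth.comp ψ.symm.contMDiff, fun c => ?_, ?_⟩
  · rw [preimage_comp, ← ψ.image_eq_preimage_symm]
    exact (hs.exhaustion c).image ψ.continuous
  · obtain ⟨K, hK, hr⟩ := hs.radial
    obtain ⟨L, hL, hZ⟩ := h.exists_Z_eq h' hl
    refine ⟨ψ '' (K ∪ L), (hK.union hL).image ψ.continuous, fun y hy => ?_⟩
    obtain ⟨x, rfl⟩ := EquivLike.surjective ψ y
    rw [(EquivLike.injective ψ).mem_set_image, mem_union, not_or] at hy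
    rw [← hZ x hy.2, differential_comp_symm]
    exact hr x hy.1

/-! ## The null foliation and its leaf space under symplectomorphisms -/

theorem IsSymplecto.mfderiv_mem_nullDistribution (h : IsSymplecto lam lam' ψ) {S : Set M} {x : M}
    {v : TangentSpace (corners n) x} (hv : v ∈ nullDistribution lam S x) :
    mfderiv (corners n) (corners n) ψ x v ∈ nullDistribution lam' (ψ '' S) (ψ x) := by
  refine ⟨mfderiv_mem_tangent_image_iff ψ |>.2 hv.1, fun w hw => ?_⟩
  obtain ⟨w, rfl⟩ := mfderiv_surjective ψ x w
  rw [h]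
  exact hv.2 w (mfderiv_mem_tangent_image_iff ψ |>.1 hw)

/-- The homeomorphism `S → ψ(S)` induced by `ψ`. -/
noncomputable def imageHomeomorph (ψ : M ≃ₘ^∞⟮corners n, corners n⟯ M') (S : Set M) : S ≃ₜ (ψ '' S : Set M') :=
  ψ.toHomeomorph.image S

theorem IsSymplecto.nullCurve (h : IsSymplecto lam lam' ψ) {S : Set M} {x y : S}
    (hxy : NullCurve lam S x y) :
    NullCurve lam' (ψ '' S) (imageHomeomorph ψ S x) (imageHomeomorph ψ S y) := by
  obtain ⟨γ, hγ, h0, h1, hd⟩ := hxy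
  refine ⟨ψ ∘ γ, ψ.contMDiff.comp_contMDiffOn hγ, congrArg ψ h0, congrArg ψ h1, fun t ht =>
    ⟨mem_image_of_mem _ (hd t ht).1, ?_⟩⟩
  have hu : UniqueMDiffWithinAt 𝓘(ℝ, ℝ) (Icc (0 : ℝ) 1) t :=
    (uniqueDiffOn_Icc zero_lt_one t ht).uniqueMDiffWithinAt
  have hc := mfderiv_comp_mfderivWithin t (ψ.mdifferentiable (by simp) (γ t))
    (hγ.mdifferentiableOn (by simp) t ht) hu
  rw [hc]
  exact h.mfderiv_mem_nullDistribution (hd t ht).2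

theorem IsSymplecto.nullCurve_iff (h : IsSymplecto lam lam' ψ) {S : Set M} {x y : S} :
    NullCurve lam' (ψ '' S) (imageHomeomorph ψ S x) (imageHomeomorph ψ S y) ↔
      NullCurve lam S x y := by
  refine ⟨fun hc => ?_, h.nullCurve⟩
  obtain ⟨γ, hγ, h0, h1, hd⟩ := h.symm.nullCurve hc
  rw [ψ.symm_image_image] at hd
  exact ⟨γ, hγ, h0.trans (ψ.symm_apply_apply x), h1.trans (ψ.symm_apply_apply y), hd⟩

theorem IsSymplecto.leafSetoid_iff (h : IsSymplecto lam lam' ψ) {S : Set M} (x y : S) :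
    leafSetoid lam S x y ↔
      leafSetoid lam' (ψ '' S) (imageHomeomorph ψ S x) (imageHomeomorph ψ S y) := by
  constructor
  · intro hxy
    change Relation.EqvGen _ _ _ at hxy
    induction hxy with
    | rel x y hxy => exact .rel _ _ (h.nullCurve hxy)
    | refl x => exact .refl _
    | symm x y _ ih => exact .symm _ _ ih
    | trans x y z _ _ ih ih' => exact .trans _ _ _ ih ih'
  -- Induction on the generated equivalence needs arbitrary endpoints in `ψ(S)`, so the claim is
  -- restated for pulled-back points.
  · suffices H : ∀ p q : (ψ '' S : Set M'), Relation.EqvGen (NullCurve lam' (ψ '' S)) p q →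
        Relation.EqvGen (NullCurve lam S) ((imageHomeomorph ψ S).symm p)
          ((imageHomeomorph ψ S).symm q) by
      intro hxy
      have := H _ _ hxy
      rwa [Homeomorph.symm_apply_apply, Homeomorph.symm_apply_apply] at this
    intro p q hpq
    induction hpq with
    | rel p q hpq =>
      refine .rel _ _ (h.nullCurve_iff.1 ?_)
      rwa [Homeomorph.apply_symm_apply, Homeomorph.apply_symm_apply]
    | refl x => exact .refl _
    | symm x y _ ih => exact .symm _ _ ih
    | trans x y z _ _ ih ih' => exact .trans _ _ _ ih ih'

/-- The homeomorphism of leaf spaces induced by a symplectomorphism. -/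
noncomputable def IsSymplecto.leafHomeomorph (h : IsSymplecto lam lam' ψ) (S : Set M) :
    LeafSpace lam S ≃ₜ LeafSpace lam' (ψ '' S) where
  toEquiv := Quotient.congr (imageHomeomorph ψ S).toEquiv h.leafSetoid_iff
  continuous_toFun := continuous_quot_lift _
    (continuous_quot_mk.comp (imageHomeomorph ψ S).continuous)
  continuous_invFun := continuous_quot_lift _
    (continuous_quot_mk.comp (imageHomeomorph ψ S).symm.continuous)

theorem IsSymplecto.leafHomeomorph_leafMap (h : IsSymplecto lam lam' ψ) (S : Set M) (x : S) :
    h.leafHomeomorph S (leafMap lam S x) = leafMap lam' (ψ '' S) (imageHomeomorph ψ S x) := rfl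

/-- The fibers of the projections to the leaf spaces correspond. -/
noncomputable def IsSymplecto.fiberHomeomorph (h : IsSymplecto lam lam' ψ) (S : Set M)
    (ℓ : LeafSpace lam' (ψ '' S)) :
    {x : S // leafMap lam S x = (h.leafHomeomorph S).symm ℓ} ≃ₜ
      {y : (ψ '' S : Set M') // leafMap lam' (ψ '' S) y = ℓ} :=
  (imageHomeomorph ψ S).subtype fun x => by
    rw [← h.leafHomeomorph_leafMap, Homeomorph.eq_symm_apply]

theorem IsSymplecto.isSection (h : IsSymplecto lam lam' ψ) {S : Set M}
    {σ : LeafSpace lam S → S} (hσ : IsSection lam S σ) :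
    IsSection lam' (ψ '' S)
      fun ℓ => imageHomeomorph ψ S (σ ((h.leafHomeomorph S).symm ℓ)) := by
  refine ⟨(imageHomeomorph ψ S).continuous.comp
    (hσ.1.comp (h.leafHomeomorph S).symm.continuous), fun ℓ => ?_⟩
  rw [← h.leafHomeomorph_leafMap, hσ.2, Homeomorph.apply_symm_apply]

/-- A local extension `G` on `U` yields the local extension `G ∘ ψ⁻¹` on `ψ(U)`. -/
theorem SmoothOnSubset.comp_symm {E' H' N : Type*} [NormedAddCommGroup E'] [NormedSpace ℝ E']
    [TopologicalSpace H'] {J : ModelWithCorners ℝ E' H'} [TopologicalSpace N] [ChartedSpace H' N]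
    {S : Set M} {g : S → N} (hg : SmoothOnSubset J n S g) :
    SmoothOnSubset J n (ψ '' S) (g ∘ (imageHomeomorph ψ S).symm) := by
  intro y
  obtain ⟨U, hU, hyU, G, hG, hGg⟩ := hg ((imageHomeomorph ψ S).symm y)
  refine ⟨ψ.symm ⁻¹' U, hU.preimage ψ.symm.continuous, hyU, G ∘ ψ.symm,
    hG.comp ψ.symm.contMDiff.contMDiffOn fun _ hz => hz, fun z hz => ?_⟩
  exact hGg ((imageHomeomorph ψ S).symm z) hz

theorem SmoothOnSubset.comp_imageHomeomorph {E' H' N : Type*} [NormedAddCommGroup E']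
    [NormedSpace ℝ E'] [TopologicalSpace H'] {J : ModelWithCorners ℝ E' H'} [TopologicalSpace N]
    [ChartedSpace H' N] {S : Set M} {g : (ψ '' S : Set M') → N}
    (hg : SmoothOnSubset J n (ψ '' S) g) : SmoothOnSubset J n S (g ∘ imageHomeomorph ψ S) := by
  intro x
  obtain ⟨U, hU, hxU, G, hG, hGg⟩ := hg (imageHomeomorph ψ S x)
  exact ⟨ψ ⁻¹' U, hU.preimage ψ.continuous, hxU, G ∘ ψ,
    hG.comp ψ.contMDiff.contMDiffOn fun _ hz => hz, fun z hz => hGg (imageHomeomorph ψ S z) hz⟩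

theorem SmoothOnSubset.postcomp {S : Set M} {g : S → M}
    (hg : SmoothOnSubset (corners n) n S g) (ψ : M ≃ₘ^∞⟮corners n, corners n⟯ M') :
    SmoothOnSubset (corners n) n S (ψ ∘ g) := by
  intro x
  obtain ⟨U, hU, hxU, G, hG, hGg⟩ := hg x
  exact ⟨U, hU, hxU, ψ ∘ G, ψ.contMDiff.comp_contMDiffOn hG, fun z hz => congrArg ψ (hGg z hz)⟩

theorem IsSymplecto.isSmoothSection (h : IsSymplecto lam lam' ψ) {S : Set M}
    {σ : LeafSpace lam S → S} (hσ : IsSmoothSection lam S σ) :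
    IsSmoothSection lam' (ψ '' S)
      fun ℓ => imageHomeomorph ψ S (σ ((h.leafHomeomorph S).symm ℓ)) := by
  refine ⟨h.isSection hσ.1, ?_⟩
  -- On `ψ(S)` the new section after projection is `ψ ∘ σ ∘ π_S` composed with the inverse of `S →
  -- ψ(S)`.
  have := SmoothOnSubset.comp_symm (ψ := ψ) (hσ.2.postcomp ψ)
  exact this

theorem IsSymplecto.isSmoothOnLeafSpace_iff (h : IsSymplecto lam lam' ψ) {S : Set M}
    (g : LeafSpace lam' (ψ '' S) → ℝ) :
    IsSmoothOnLeafSpace lam' (ψ '' S) g ↔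
      IsSmoothOnLeafSpace lam S (g ∘ h.leafHomeomorph S) := by
  refine ⟨fun hg => SmoothOnSubset.comp_imageHomeomorph hg, fun hg => ?_⟩
  have h1 := SmoothOnSubset.comp_symm (ψ := ψ) hg
  have h2 : (fun y => g (leafMap lam' (ψ '' S) y)) =
      (fun x => (g ∘ h.leafHomeomorph S) (leafMap lam S x)) ∘ (imageHomeomorph ψ S).symm := by
    funext y
    simp only [Function.comp_apply, h.leafHomeomorph_leafMap, Homeomorph.apply_symm_apply]
  rw [IsSmoothOnLeafSpace, h2]
  exact h1

/-- Valid for any subset, since the leaf relation is built from tangent spaces and `dλ` alone. -/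
theorem IsSymplecto.descendsToLeafSpace {lam : OneForm n M}
    {ψ : M ≃ₘ^∞⟮corners n, corners n⟯ M} (h : IsSymplecto lam lam ψ) (S : Set M) :
    DescendsToLeafSpace lam ψ S :=
  ⟨h.leafHomeomorph S, fun _ => rfl, h.isSmoothOnLeafSpace_iff,
    fun _ => ⟨h.isSection, h.isSmoothSection⟩⟩

end Symplectomorphisms

/-! ### Transport of σ-sectors and their constituents -/

section Sectors

variable {n : ℕ}
variable {M : Type*} [TopologicalSpace M] [ChartedSpace (EuclideanQuadrant (2 * n)) M]
variable {M' : Type*} [TopologicalSpace M'] [ChartedSpace (EuclideanQuadrant (2 * n)) M']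
variable {lam : OneForm n M} {lam' : OneForm n M'} {ψ : M ≃ₘ^∞⟮corners n, corners n⟯ M'}

theorem IsSymplecto.isCoisotropic (h : IsSymplecto lam lam' ψ) {S : Set M}
    (hS : IsCoisotropic lam S) : IsCoisotropic lam' (ψ '' S) := by
  rintro _ ⟨x, hx, rfl⟩ v hv
  obtain ⟨v, rfl⟩ := mfderiv_surjective ψ x v
  rw [mfderiv_mem_tangent_image_iff]
  exact hS x hx v fun w hw =>
    (h x v w).symm.trans (hv _ ((mfderiv_mem_tangent_image_iff ψ).2 hw))

/-- Injectivity handles nonempty `I`; surjectivity handles the empty one, where both sides are the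
whole manifold. -/
theorem image_biInter_finset {m : ℕ} (ψ : M ≃ₘ^∞⟮corners n, corners n⟯ M') (H : Fin m → Set M)
    (I : Finset (Fin m)) : ⋂ i ∈ I, ψ '' H i = ψ '' ⋂ i ∈ I, H i :=
  (image_iInter₂ (EquivLike.bijective ψ) _).symm

/-! ## Forms that differ by a compactly supported exact form -/

theorem differential_eq_zero {f : M → ℝ} {x : M} (hx : x ∉ tsupport f) :
    (differential f x : TangentSpace (corners n) x →L[ℝ] ℝ) = 0 := by
  have h : f =ᶠ[𝓝 x] fun _ => 0 := notMem_tsupport_iff_eventuallyEq.1 hx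
  exact h.mfderiv_eq.trans mfderiv_const

theorem isStrictAtInfinity_of_pullback_eq {f : M → ℝ} (hf : HasCompactSupport f)
    (hψ : pullback ψ lam' = lam + differential f) : IsStrictAtInfinity lam lam' ψ := by
  refine ⟨tsupport f, hf, fun x hx v => ?_⟩
  have h := DFunLike.congr_fun (congrFun hψ x) v
  rw [Pi.add_apply, differential_eq_zero hx, add_zero] at h
  exact h

theorem pullback_refl (lam : OneForm n M) :
    pullback (Diffeomorph.refl (corners n) M ∞) lam = lam := by
  funext x
  ext v
  change lam x (mfderiv (corners n) (corners n) id x v) = lam x v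
  rw [mfderiv_id]
  rfl

theorem differential_neg (f : M → ℝ) : (differential (-f) : OneForm n M) = -differential f := by
  funext x
  exact mfderiv_neg

/-! ## Pushing forward vector fields -/

/-- The push-forward of a vector field by a diffeomorphism. -/
noncomputable def pushforward (ψ : M ≃ₘ^∞⟮corners n, corners n⟯ M')
    (η : ∀ x : M, TangentSpace (corners n) x) (y : M') : TangentSpace (corners n) y :=
  (mfderiv (corners n) (corners n) ψ (ψ.symm y) (η (ψ.symm y)) : EuclideanSpace ℝ (Fin (2 * n)))

theorem pushforward_apply (η : ∀ x : M, TangentSpace (corners n) x) (x : M) :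
    pushforward ψ η (ψ x) = mfderiv (corners n) (corners n) ψ x (η x) := by
  have H : ∀ x' : M, x' = x →
      (mfderiv (corners n) (corners n) ψ x' (η x') : EuclideanSpace ℝ (Fin (2 * n))) =
        mfderiv (corners n) (corners n) ψ x (η x) := by
    rintro _ rfl; rfl
  exact H _ (ψ.symm_apply_apply x)

variable [IsManifold (corners n) ∞ M] [IsManifold (corners n) ∞ M']

/-- The push-forward is the composite of `ψ⁻¹`, the section `η` and the tangent map of `ψ`, up to
rewriting the base point `ψ (ψ⁻¹ y)` as `y`. -/
theorem contMDiffOn_pushforward {U : Set M} {η : ∀ x : M, TangentSpace (corners n) x}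
    (hη : ContMDiffOn (corners n) (corners n).tangent ∞
      (fun x => (⟨x, η x⟩ : TangentBundle (corners n) M)) U) :
    ContMDiffOn (corners n) (corners n).tangent ∞
      (fun y => (⟨y, pushforward ψ η y⟩ : TangentBundle (corners n) M')) (ψ.symm ⁻¹' U) := by
  have h := ((ψ.contMDiff.contMDiff_tangentMap (m := ∞) (by simp)).comp_contMDiffOn hη).comp
    ψ.symm.contMDiff.contMDiffOn (s := ψ.symm ⁻¹' U) fun _ hy => hy
  refine h.congr fun y _ => ?_
  have H : ∀ (p q : M') (a : EuclideanSpace ℝ (Fin (2 * n))), p = q →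
      (⟨p, a⟩ : TangentBundle (corners n) M') = ⟨q, a⟩ := by
    rintro p _ a rfl; rfl
  exact H _ _ _ (ψ.apply_symm_apply y).symm

/-! ### Liouville structures, exact deformations and clean coisotropic collections -/

theorem IsSymplecto.isLiouville (h : IsSymplecto lam lam' ψ)
    (h' : IsStrictAtInfinity lam lam' ψ) (hs : lam'.IsSmooth) (hM : IsLiouville lam) :
    IsLiouville lam' where
  smooth := hs
  symplectic := h.isSymplectic hM.symplectic
  cylindrical := hM.cylindrical.imp' _ fun _ => h.isRadial h' hM.symplectic
  tangent_strata := by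
    -- Treating the strata as one family keeps a single compact set valid for all depths.
    obtain ⟨K, hK, hZ⟩ := h.Z_mem_tangent_image h' hM.symplectic (S := stratum n M)
      hM.tangent_strata
    refine ⟨K, hK, fun y hy m hm => ?_⟩
    have := hZ y hy m
    rw [image_stratum] at this
    exact this hm

theorem isSymplecto_of_pullback_eq (hl : lam.IsSmooth) (hl' : lam'.IsSmooth) {f : M → ℝ}
    (hf : ContMDiff (corners n) 𝓘(ℝ, ℝ) ∞ f) (hψ : pullback ψ lam' = lam + differential f) :
    IsSymplecto lam lam' ψ := fun x v w => by
  rw [← d_pullback ψ.contMDiff hl', hψ, OneForm.d_add hl (isSmooth_differential hf),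
    d_differential hf, add_zero]

theorem IsSymplecto.isCleanCoisotropic (h : IsSymplecto lam lam' ψ)
    (h' : IsStrictAtInfinity lam lam' ψ) (hl : lam.IsSymplectic) {m : ℕ} {H : Fin m → Set M}
    (hH : IsCleanCoisotropic lam H) : IsCleanCoisotropic lam' fun i => ψ '' H i where
  submanifold I hI := by
    rw [image_biInter_finset]
    exact (hH.submanifold I hI).image ψ
  clean I hI := by
    rw [image_biInter_finset]
    rintro _ ⟨x, hx, rfl⟩
    ext v
    obtain ⟨v, rfl⟩ := mfderiv_surjective ψ x v
    simp only [Submodule.mem_iInf, mfderiv_mem_tangent_image_iff, hH.clean I hI x hx]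
  cylindrical i := by
    obtain ⟨K, hK, hZ⟩ := hH.cylindrical i
    obtain ⟨K', hK', hZ'⟩ := h.Z_mem_tangent_image h' hl (S := fun _ : Unit => H i)
      ⟨K, hK, fun x hx _ hxH => hZ x hxH hx⟩
    exact ⟨K', hK', fun y hy hyK => hZ' y hyK () hy⟩
  coisotropic i j hij := by
    rw [← image_inter (EquivLike.injective ψ)]
    exact h.isCoisotropic (hH.coisotropic i j hij)

/-- The inverse of an isomorphism of `σ`-sectors is an isomorphism. -/
theorem IsSigmaSectorIso.symm [T2Space M'] (h : IsSigmaSectorIso lam lam' ψ) :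
    IsSigmaSectorIso lam' lam ψ.symm := by
  obtain ⟨hM, hM', f, hf, hfc, hψ⟩ := h
  -- Pulling `ψ^*λ' = λ + df` back by `ψ⁻¹` gives `(ψ⁻¹)^*λ = λ' - d(f ∘ ψ⁻¹)`.
  refine ⟨hM', hM, -(f ∘ ψ.symm), (hf.comp ψ.symm.contMDiff).neg,
    (hfc.comp_homeomorph ψ.symm.toHomeomorph).neg, ?_⟩
  funext y
  obtain ⟨x, rfl⟩ := EquivLike.surjective ψ y
  ext w
  obtain ⟨w, rfl⟩ := mfderiv_surjective ψ x w
  have h1 := DFunLike.congr_fun (congrFun hψ x) w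
  have h2 : pullback ψ.symm lam (ψ x) (mfderiv (corners n) (corners n) ψ x w) = lam x w := by
    change lam _ (mfderiv _ _ ψ.symm (ψ x) (mfderiv (corners n) (corners n) ψ x w)) = lam x w
    rw [mfderiv_symm_mfderiv]
    exact lam.apply_congr (ψ.symm_apply_apply x) w
  rw [h2, differential_neg]
  change lam' (ψ x) (mfderiv (corners n) (corners n) ψ x w) = lam x w + differential f x w at h1
  change lam x w = lam' (ψ x) (mfderiv (corners n) (corners n) ψ x w) +
    -differential (f ∘ ψ.symm) (ψ x) (mfderiv (corners n) (corners n) ψ x w)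
  rw [differential_comp_symm, h1]
  ring

/-! ### Contact vector fields and convexity at infinity -/

variable [T2Space M]

/-- The slice misses `K`, so at its points `ψ` matches `λ` as well as `dλ`, and the same factor `g`
works. -/
theorem IsSymplecto.isContactField (h : IsSymplecto lam lam' ψ) {K : Set M} (hK : IsCompact K)
    (hs : ∀ x ∉ K, ∀ v, lam' (ψ x) (mfderiv (corners n) (corners n) ψ x v) = lam x v)
    {s : M → ℝ} {c : ℝ} (hc : ∀ x ∈ K, s x ≠ c) {U : Set M}
    {η : ∀ x : M, TangentSpace (corners n) x} (hη : IsContactField lam s c U η) :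
    IsContactField lam' (s ∘ ψ.symm) c (ψ.symm ⁻¹' U) (pushforward ψ η) := by
  refine ⟨contMDiffOn_pushforward hη.smooth, fun y hy hyc => ?_, fun y hy hyc => ?_⟩
  · obtain ⟨x, rfl⟩ := EquivLike.surjective ψ y
    rw [mem_preimage, ψ.symm_apply_apply] at hy
    rw [Function.comp_apply, ψ.symm_apply_apply] at hyc
    rw [pushforward_apply, differential_comp_symm]
    exact hη.tangent x hy hyc
  · obtain ⟨x, rfl⟩ := EquivLike.surjective ψ y
    rw [mem_preimage, ψ.symm_apply_apply] at hy
    rw [Function.comp_apply, ψ.symm_apply_apply] at hyc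
    obtain ⟨g, hg⟩ := hη.contact x hy hyc
    have hxK : x ∉ K := fun hx => hc x hx hyc
    refine ⟨g, fun w hw => ?_⟩
    obtain ⟨w, rfl⟩ := mfderiv_surjective ψ x w
    rw [differential_comp_symm] at hw
    -- The contact condition differentiates `λ(η)`, so agreement is needed near `x`; compact `K` is
    -- closed in a Hausdorff space, so its complement is a neighbourhood of `x`.
    have hcomp : (fun y => lam' y (pushforward ψ η y)) ∘ ψ =ᶠ[𝓝 x] fun z => lam z (η z) := by
      filter_upwards [hK.isClosed.isOpen_compl.mem_nhds hxK] with z hz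
      rw [Function.comp_apply, pushforward_apply, hs z hz]
    have hdiff : differential ((fun y => lam' y (pushforward ψ η y)) ∘ ψ) x w =
        differential (fun z => lam z (η z)) x w :=
      congrArg (fun A : EuclideanSpace ℝ (Fin (2 * n)) →L[ℝ] ℝ => A w) hcomp.mfderiv_eq
    rw [differential_comp, hdiff, pushforward_apply, h, hs x hxK]
    exact hg w hw

theorem IsSymplecto.isConvexAtInfinity (h : IsSymplecto lam lam' ψ)
    (h' : IsStrictAtInfinity lam lam' ψ) (hl : lam.IsSymplectic) {H : Set M}
    (hH : IsConvexAtInfinity lam H) : IsConvexAtInfinity lam' (ψ '' H) := by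
  obtain ⟨s, hs, hc⟩ := hH
  refine ⟨s ∘ ψ.symm, h.isRadial h' hl hs, ?_⟩
  obtain ⟨K, hK, hst⟩ := h'
  -- Slices with `c > b` avoid `K`, where `λ` may fail to be preserved.
  obtain ⟨b, hb⟩ := (hK.image hs.smooth.continuous).bddAbove
  filter_upwards [hc, eventually_gt_atTop b] with c ⟨U, η, hU, hHU, hη, ht⟩ hbc
  refine ⟨ψ.symm ⁻¹' U, pushforward ψ η, hU.preimage ψ.symm.continuous, ?_,
    h.isContactField hK hst (fun x hx => ((hb (mem_image_of_mem s hx)).trans_lt hbc).ne) hη, ?_⟩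
  · rintro _ ⟨⟨x, hx, rfl⟩, hxc⟩
    rw [mem_preimage, Function.comp_apply, ψ.symm_apply_apply] at hxc
    rw [mem_preimage, ψ.symm_apply_apply]
    exact hHU ⟨hx, hxc⟩
  · rintro _ ⟨⟨x, hx, rfl⟩, hxc⟩
    rw [mem_preimage, Function.comp_apply, ψ.symm_apply_apply] at hxc
    rw [pushforward_apply, mfderiv_mem_tangent_image_iff]
    exact ht x ⟨hx, hxc⟩

/-! ## `σ`-sectorial hypersurfaces, corners and sectors -/

theorem IsSymplecto.isSigmaSectorialHypersurface (h : IsSymplecto lam lam' ψ)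
    (h' : IsStrictAtInfinity lam lam' ψ) (hl : lam.IsSymplectic) {H : Set M}
    (hH : IsSigmaSectorialHypersurface lam H) :
    IsSigmaSectorialHypersurface lam' (ψ '' H) where
  closed := ψ.toHomeomorph.isClosedMap _ hH.closed
  hypersurface := hH.hypersurface.image ψ
  tangent_at_infinity := by
    obtain ⟨K, hK, hZ⟩ := hH.tangent_at_infinity
    obtain ⟨K', hK', hZ'⟩ := h.Z_mem_tangent_image h' hl (S := fun _ : Unit => H)
      ⟨K, hK, fun x hx _ hxH => hZ x hxH hx⟩
    exact ⟨K', hK', fun y hy hyK => hZ' y hyK () hy⟩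
  convex_at_infinity := h.isConvexAtInfinity h' hl hH.convex_at_infinity
  exists_section := hH.exists_section.imp' _ fun _ hσ => h.isSection hσ
  fibers ℓ := (hH.fibers ((h.leafHomeomorph H).symm ℓ)).map (h.fiberHomeomorph H ℓ).symm.trans

theorem IsSymplecto.isSigmaSectorialCorner (h : IsSymplecto lam lam' ψ)
    (h' : IsStrictAtInfinity lam lam' ψ) (hl : lam.IsSymplectic) {m : ℕ} {δ : Set M}
    {H : Fin m → Set M} (hH : IsSigmaSectorialCorner lam m δ H) :
    IsSigmaSectorialCorner lam' m (ψ '' δ) fun i => ψ '' H i := by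
  have hI : ⋂ i, ψ '' H i = ψ '' ⋂ i, H i := (image_iInter (EquivLike.bijective ψ) _).symm
  refine ⟨hH.corner.image ψ, fun i => h.isSigmaSectorialHypersurface h' hl (hH.sectorial i),
    fun i => ?_, h.isCleanCoisotropic h' hl hH.collection, ?_, ?_, ?_⟩
  · rw [← ψ.image_boundary (by simp)]
    exact image_mono (hH.boundary i)
  · rw [hI]
    exact image_mono hH.subset
  · rw [hI, ← image_stratum ψ m]
    exact (image_mono hH.subset_closure).trans (ψ.toHomeomorph.image_closure _).subset
  · rw [hI]
    intro ℓ
    exact (h.fiberHomeomorph (⋂ i, H i) ℓ).contractibleSpace_iff.1 (hH.fibers _)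

theorem IsSymplecto.isSigmaSector (h : IsSymplecto lam lam' ψ)
    (h' : IsStrictAtInfinity lam lam' ψ) (hs : lam'.IsSmooth) (hM : IsSigmaSector lam) :
    IsSigmaSector lam' where
  liouville := h.isLiouville h' hs hM.liouville
  sectorial m hm δ hδ := by
    -- A corner of the target is the image of the corner `ψ⁻¹(δ)`, so a presentation of the latter
    -- is pushed forward.
    obtain ⟨H, hH⟩ := hM.sectorial m hm (ψ.symm '' δ) (hδ.image ψ.symm)
    have := h.isSigmaSectorialCorner h' hM.liouville.symplectic hH
    rw [ψ.image_symm_image] at this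
    exact ⟨_, this⟩

theorem IsSymplecto.isSigmaSectorialHypersurface_iff [T2Space M'] (h : IsSymplecto lam lam' ψ)
    (h' : IsStrictAtInfinity lam lam' ψ) (hl : lam.IsSymplectic) (H : Set M) :
    IsSigmaSectorialHypersurface lam H ↔ IsSigmaSectorialHypersurface lam' (ψ '' H) := by
  refine ⟨h.isSigmaSectorialHypersurface h' hl, fun hH => ?_⟩
  have := h.symm.isSigmaSectorialHypersurface h'.symm (h.isSymplectic hl) hH
  rwa [ψ.symm_image_image] at this

theorem IsSymplecto.isSigmaSectorialCorner_iff [T2Space M'] (h : IsSymplecto lam lam' ψ)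
    (h' : IsStrictAtInfinity lam lam' ψ) (hl : lam.IsSymplectic) (m : ℕ) (δ : Set M)
    (H : Fin m → Set M) : IsSigmaSectorialCorner lam m δ H ↔
      IsSigmaSectorialCorner lam' m (ψ '' δ) fun i => ψ '' H i := by
  refine ⟨h.isSigmaSectorialCorner h' hl, fun hH => ?_⟩
  have := h.symm.isSigmaSectorialCorner h'.symm (h.isSymplectic hl) hH
  simpa only [ψ.symm_image_image] using this

/-! ## Isomorphisms of `σ`-sectors -/

/-- A diffeomorphism with `ψ^* λ' = λ + df` is an isomorphism as soon as its source is a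
`σ`-sector. -/
theorem IsSigmaSector.iso_of_pullback_eq (hM : IsSigmaSector lam) (hl' : lam'.IsSmooth)
    {f : M → ℝ} (hf : ContMDiff (corners n) 𝓘(ℝ, ℝ) ∞ f) (hfc : HasCompactSupport f)
    (hψ : pullback ψ lam' = lam + differential f) : IsSigmaSectorIso lam lam' ψ :=
  ⟨hM, (isSymplecto_of_pullback_eq hM.liouville.smooth hl' hf hψ).isSigmaSector
    (isStrictAtInfinity_of_pullback_eq hfc hψ) hl' hM, f, hf, hfc, hψ⟩

end Sectors

end SigmaSector

/-! ### The automorphism theorem -/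

open SigmaSector in
theorem mainTheorem10 (n : ℕ) (M : Type*) [TopologicalSpace M] [T2Space M]
    [SecondCountableTopology M] [ChartedSpace (EuclideanQuadrant (2 * n)) M]
    [IsManifold (corners n) ∞ M]
    (lam : OneForm n M) (hM : IsSigmaSector lam)
    (ψ : M ≃ₘ^∞⟮corners n, corners n⟯ M)
    (f : M → ℝ) (hf : ContMDiff (corners n) 𝓘(ℝ, ℝ) ∞ f) (hfc : HasCompactSupport f)
    (hψ : pullback ψ lam = lam + differential f) :
    -- `ψ` and its inverse are automorphisms, and `(M, ψ^* λ)` is an isomorphic `σ`-sector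
    IsSigmaSectorIso lam lam ψ ∧
    IsSigmaSectorIso lam lam ψ.symm ∧
    IsSigmaSectorIso (pullback ψ lam) lam ψ ∧
    IsSigmaSectorIso (pullback ψ lam) lam (Diffeomorph.refl (corners n) M ∞) ∧
    -- `ψ` is symplectic and preserves the stratification
    (∀ (x : M) (v w : TangentSpace (corners n) x),
      lam.d (ψ x) (mfderiv (corners n) (corners n) ψ x v) (mfderiv (corners n) (corners n) ψ x w) =
        lam.d x v w) ∧
    (∀ m : ℕ, ψ '' stratum n M m = stratum n M m) ∧
    -- `ψ` preserves `σ`-sectorial hypersurfaces and `σ`-sectorial corners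
    (∀ H : Set M, IsSigmaSectorialHypersurface lam H ↔ IsSigmaSectorialHypersurface lam (ψ '' H)) ∧
    (∀ (m : ℕ) (δ : Set M) (H : Fin m → Set M),
      IsSigmaSectorialCorner lam m δ H ↔
        IsSigmaSectorialCorner lam m (ψ '' δ) (fun i => ψ '' H i)) ∧
    -- induced maps and sections on the leaf spaces
    (∀ H : Set M, IsSigmaSectorialHypersurface lam H → DescendsToLeafSpace lam ψ H) ∧
    (∀ (m : ℕ) (δ : Set M) (H : Fin m → Set M),
      IsSigmaSectorialCorner lam m δ H → DescendsToLeafSpace lam ψ (⋂ i, H i)) := by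
  have hl := hM.liouville.smooth
  have hsym := isSymplecto_of_pullback_eq hl hl hf hψ
  have hstr := isStrictAtInfinity_of_pullback_eq hfc hψ
  have hiso := hM.iso_of_pullback_eq hl hf hfc hψ
  -- Smoothness of `ψ^*λ` is read off from its expression as `λ + df`.
  have hmu : (pullback ψ lam).IsSmooth := hψ ▸ hl.add (isSmooth_differential hf)
  -- The identity pulls `ψ^*λ` back to `λ + df`, so it satisfies the same relation with the same
  -- `f`; its target is thereby a σ-sector.
  have hrefl : IsSigmaSectorIso lam (pullback ψ lam) (Diffeomorph.refl (corners n) M ∞) :=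
    hM.iso_of_pullback_eq hmu hf hfc (by rw [pullback_refl, hψ])
  refine ⟨hiso, hiso.symm, ?_, hrefl.symm, hsym, image_stratum ψ,
    hsym.isSigmaSectorialHypersurface_iff hstr hM.liouville.symplectic,
    hsym.isSigmaSectorialCorner_iff hstr hM.liouville.symplectic,
    fun H _ => hsym.descendsToLeafSpace H, fun _ _ H _ => hsym.descendsToLeafSpace (⋂ i, H i)⟩
  -- As a map from `(M, ψ^*λ)` to `(M, λ)`, `ψ` preserves the one-forms exactly, so the correcting
  -- function is zero.
  refine hrefl.target.iso_of_pullback_eq hl (f := 0) contMDiff_const .zero ?_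
  have h0 : (differential (0 : M → ℝ) : OneForm n M) = 0 := funext fun x => mfderiv_const
  rw [h0, add_zero]
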